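/- Let $\mathcal M$ be a reproducing kernel Hilbert space of complex-valued functions on a set $X$ whose multiplier algebra $\mathrm{Mult}(\mathcal M)=\{\varphi:X\to\mathbb C : \varphi f\in\mathcal M \text{ for all } f\in\mathcal M\}$ is contained in $\mathcal M$ and dense in it; in particular $1\in\mathcal M$. Let $$\mathcal M\odot\mathcal M=\Big\{\sum_{n=1}^\infty f_ng_n : f_n,g_n\in\mathcal M,\ \sum_n\|f_n\|_{\mathcal M}\|g_n\|_{\mathcal M}<\infty\Big\}$$ (pointwise sums), with $\|h\|$ the infimum of $\sum_n\|f_n\|\|g_n\|$ over all representations $h=\sum_n f_ng_n$. Let $\mathrm{Han}$ be the anti-dual of $\mathcal M\odot\mathcal M$, realized as the space of Hankel symbols: $\mathrm{Han}$ consists of all functions $b=S1$, where $S:\mathcal M\to\mathcal M$ is a bounded conjugate-linear map such that $\sum_n\langle g_n,Sf_n\rangle=0$ whenever $\sum_n\|f_n\|\|g_n\|<\infty$ and $\sum_n f_n(x)g_n(x)=0$ for all $x\in X$; the map $S$ is determined by $b$, and $\|b\|_{\mathrm{Han}}=\|S\|$. For $1\le p<\infty$ let $$\mathcal H^p=[\mathcal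 M\odot\mathcal M,\ \mathrm{Han}]_{[\theta]},\qquad \theta=\tfrac{p-1}{p},$$ be the complex (Calderón) interpolation space. Then: 1. For $1\le p<\infty$, $\mathcal H^p$ is a Banach function space on $X$, that is, a linear space of functions on $X$, complete in its norm, on which all point evaluations are continuous. 2. For $1\le p\le q<\infty$, $$\mathcal M\odot\mathcal M\ \supseteq\ \mathcal H^p\ \supseteq\ \mathcal H^q\ \supseteq\ \mathrm{Han},$$ and these three inclusions are bounded, of norm at most $\|1\|_{\mathcal M}^{2(1-1/p)}$, $\|1\|_{\mathcal M}^{2(1/p-1/q)}$ and $\|1\|_{\mathcal M}^{2/q}$, respectively. 3. In particular, if $\|1\|_{\mathcal M}\le 1$ (for example, if the kernel is normalized, $k(x_0,\cdot)=1$ for some $x_0\in X$), then the three inclusions are contractive. -/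

import Mathlib

noncomputable section

open scoped Topology
open Complex.HadamardThreeLines (verticalStrip verticalClosedStrip)

/-- A normed space of functions on `X`: a linear subspace of `X → ℂ` with a seminorm for which all
point evaluations are bounded (so that it is a norm). It need not be complete. -/
structure FunctionSpace (X : Type*) where
  carrier : Submodule ℂ (X → ℂ)
  seminorm : Seminorm ℂ carrier
  eval_bounded : ∀ x : X, ∃ C : ℝ, ∀ f : carrier, ‖f.1 x‖ ≤ C * seminorm f

namespace FunctionSpace

variable {X : Type*}

/-- The elements of `A`. This is a type of its own, so that it carries the topology of the seminorm
of `A` and not the topology of pointwise convergence. -/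
def Elem (A : FunctionSpace X) : Type _ := A.carrier

instance (A : FunctionSpace X) : AddCommGroup A.Elem := inferInstanceAs (AddCommGroup A.carrier)

instance (A : FunctionSpace X) : Module ℂ A.Elem := inferInstanceAs (Module ℂ A.carrier)

instance (A : FunctionSpace X) : NormedAddCommGroup A.Elem :=
  AddGroupNorm.toNormedAddCommGroup (E := A.Elem)
    { A.seminorm.toAddGroupSeminorm with
      eq_zero_of_map_eq_zero' := fun f hf => Subtype.ext <| funext fun x => by
        obtain ⟨C, hC⟩ := A.eval_bounded x
        have h := hC f
        rw [show A.seminorm f = 0 from hf, mul_zero] at h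
        exact norm_le_zero_iff.1 h }

instance (A : FunctionSpace X) : NormedSpace ℂ A.Elem where
  norm_smul_le c f := le_of_eq (map_smul_eq_mul A.seminorm c f)

/-- An element of `A`, as a function on `X`. -/
def toFun {A : FunctionSpace X} (f : A.Elem) : X → ℂ := (show A.carrier from f).1

theorem toFun_zero (A : FunctionSpace X) : toFun (0 : A.Elem) = 0 := rfl

theorem toFun_add {A : FunctionSpace X} (f g : A.Elem) : toFun (f + g) = toFun f + toFun g := rfl

theorem toFun_smul {A : FunctionSpace X} (c : ℂ) (f : A.Elem) : toFun (c • f) = c • toFun f := rfl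

theorem norm_toFun_le (A : FunctionSpace X) (x : X) :
    ∃ C : ℝ, 0 ≤ C ∧ ∀ f : A.Elem, ‖toFun f x‖ ≤ C * ‖f‖ := by
  obtain ⟨C, hC⟩ := A.eval_bounded x
  exact ⟨|C|, abs_nonneg C, fun f =>
    (hC f).trans (mul_le_mul_of_nonneg_right (le_abs_self C) (norm_nonneg f))⟩

/-- Point evaluation at `x`, as a bounded linear functional on `A`. -/
def evalCLM (A : FunctionSpace X) (x : X) : A.Elem →L[ℂ] ℂ :=
  LinearMap.mkContinuousOfExistsBound
    { toFun := fun f => toFun f x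
      map_add' := fun f g => by rw [toFun_add, Pi.add_apply]
      map_smul' := fun c f => by rw [toFun_smul, Pi.smul_apply, RingHom.id_apply] }
    ((norm_toFun_le A x).imp fun _ h => h.2)

/-- `A` is a Banach function space on `X`: it is complete, and all point evaluations are
continuous. -/
def IsBanachFunctionSpace (A : FunctionSpace X) : Prop :=
  CompleteSpace A.Elem ∧ ∀ x : X, Continuous fun f : A.Elem => toFun f x

/-- `B ⊆ A` as sets of functions, and `‖f‖_A ≤ C ‖f‖_B` for all `f` in `B`. -/
def IncludedWithBound (B A : FunctionSpace X) (C : ℝ) : Prop :=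
  ∀ f : B.Elem, ∃ g : A.Elem, toFun g = toFun f ∧ ‖g‖ ≤ C * ‖f‖

/-- `B ⊆ A` contractively. -/
def ContractivelyIncluded (B A : FunctionSpace X) : Prop :=
  ∀ f : B.Elem, ∃ g : A.Elem, toFun g = toFun f ∧ ‖g‖ ≤ ‖f‖

/-- The conditions on a relation `R f r` (read: `f` has a representation of cost `r`) under which
the infimum of the costs is a norm with bounded point evaluations. -/
structure IsCost (R : (X → ℂ) → ℝ → Prop) : Prop where
  zero : R 0 0
  nonneg : ∀ {f r}, R f r → 0 ≤ r
  add : ∀ {f g r s}, R f r → R g s → R (f + g) (r + s)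
  smul : ∀ (c : ℂ) {f r}, R f r → R (c • f) (‖c‖ * r)
  eval : ∀ x : X, ∃ C : ℝ, 0 ≤ C ∧ ∀ {f r}, R f r → ‖f x‖ ≤ C * r

/-- The space of all functions that have a representation; the norm of a function is the
infimum of the costs of its representations. -/
def ofCost (R : (X → ℂ) → ℝ → Prop) (hR : IsCost R) : FunctionSpace X where
  carrier :=
    { carrier := {f | ∃ r, R f r}
      zero_mem' := ⟨0, hR.zero⟩
      add_mem' := fun ⟨_, hr⟩ ⟨_, hs⟩ => ⟨_, hR.add hr hs⟩
      smul_mem' := fun c _ ⟨_, hr⟩ => ⟨_, hR.smul c hr⟩ }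
  seminorm := Seminorm.ofSMulLE (fun f => sInf {r | R f.1 r})
    (le_antisymm (csInf_le ⟨0, fun _ h => hR.nonneg h⟩ hR.zero)
      (le_csInf ⟨0, hR.zero⟩ fun _ h => hR.nonneg h))
    (by
      intro f g
      have bd : ∀ h : X → ℂ, BddBelow {r | R h r} := fun h => ⟨0, fun _ h => hR.nonneg h⟩
      have h1 : ∀ s, R g.1 s → ∀ r, R f.1 r → sInf {r | R (f.1 + g.1) r} - s ≤ r := fun s hs r hr =>
        sub_le_iff_le_add.2 (csInf_le (bd _) (hR.add hr hs))
      have h2 : ∀ s, R g.1 s → sInf {r | R (f.1 + g.1) r} - sInf {r | R f.1 r} ≤ s := fun s hs => by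
        have := le_csInf f.2 (h1 s hs)
        exact sub_le_comm.1 this
      have h3 := le_csInf g.2 h2
      exact sub_le_iff_le_add'.1 h3)
    (by
      intro c f
      have bd : ∀ h : X → ℂ, BddBelow {r | R h r} := fun h => ⟨0, fun _ h => hR.nonneg h⟩
      have h0 : 0 ≤ sInf {r | R f.1 r} := Real.sInf_nonneg fun _ h => hR.nonneg h
      refine le_of_forall_pos_le_add fun ε hε => ?_
      obtain ⟨r, hr, hlt⟩ := exists_lt_of_csInf_lt f.2
        (lt_add_of_pos_right (sInf {r | R f.1 r}) (show 0 < ε / (‖c‖ + 1) by positivity))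
      refine (csInf_le (bd _) (hR.smul c hr)).trans ?_
      have h4 : ‖c‖ * (ε / (‖c‖ + 1)) ≤ ε := by
        rw [mul_div_assoc', div_le_iff₀ (by positivity)]
        nlinarith [norm_nonneg c]
      nlinarith [norm_nonneg c])
  eval_bounded := fun x => by
    obtain ⟨C, hC0, hC⟩ := hR.eval x
    refine ⟨C, fun f => ?_⟩
    change _ ≤ C * sInf {r | R f.1 r}
    rw [← smul_eq_mul, ← Real.sInf_smul_of_nonneg hC0]
    refine le_csInf (Set.Nonempty.smul_set f.2) ?_
    rintro _ ⟨r, hr, rfl⟩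
    exact hC hr

/-! ### Complex interpolation -/

/-- `f = a₀ + a₁` with `a₀` in `A₀`, `a₁` in `A₁` and `‖a₀‖ + ‖a₁‖ ≤ r`. -/
def SumCost (A₀ A₁ : FunctionSpace X) (f : X → ℂ) (r : ℝ) : Prop :=
  ∃ (a₀ : A₀.Elem) (a₁ : A₁.Elem), toFun a₀ + toFun a₁ = f ∧ ‖a₀‖ + ‖a₁‖ ≤ r

theorem isCost_sumCost (A₀ A₁ : FunctionSpace X) : IsCost (SumCost A₀ A₁) where
  zero := ⟨0, 0, by simp [toFun_zero], by simp⟩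
  nonneg := fun ⟨a₀, a₁, _, h⟩ => (add_nonneg (norm_nonneg a₀) (norm_nonneg a₁)).trans h
  add := by
    rintro _ _ r s ⟨a₀, a₁, rfl, h⟩ ⟨b₀, b₁, rfl, h'⟩
    refine ⟨a₀ + b₀, a₁ + b₁, by rw [toFun_add, toFun_add, add_add_add_comm], ?_⟩
    linarith [norm_add_le a₀ b₀, norm_add_le a₁ b₁]
  smul := by
    rintro c _ r ⟨a₀, a₁, rfl, h⟩
    refine ⟨c • a₀, c • a₁, by rw [toFun_smul, toFun_smul, smul_add], ?_⟩
    rw [norm_smul, norm_smul, ← mul_add]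
    gcongr
  eval := fun x => by
    obtain ⟨C, hC0, hC⟩ := norm_toFun_le A₀ x
    obtain ⟨D, hD0, hD⟩ := norm_toFun_le A₁ x
    refine ⟨max C D, le_max_of_le_left hC0, ?_⟩
    rintro _ r ⟨a₀, a₁, rfl, h⟩
    calc ‖(toFun a₀ + toFun a₁) x‖ ≤ C * ‖a₀‖ + D * ‖a₁‖ :=
          (norm_add_le _ _).trans (add_le_add (hC a₀) (hD a₁))
      _ ≤ max C D * ‖a₀‖ + max C D * ‖a₁‖ := by
          gcongr
          · exact le_max_left C D
          · exact le_max_right C D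
      _ ≤ max C D * r := by
          rw [← mul_add]
          exact mul_le_mul_of_nonneg_left h (le_max_of_le_left hC0)

/-- The sum `A₀ + A₁` of a couple of function spaces, with the norm
`inf {‖a₀‖ + ‖a₁‖ : f = a₀ + a₁}`. -/
def sum (A₀ A₁ : FunctionSpace X) : FunctionSpace X := ofCost (SumCost A₀ A₁) (isCost_sumCost A₀ A₁)

/-- Calderón's class of functions on the closed strip `0 ≤ Re z ≤ 1` with values in `A₀ + A₁`:
bounded and continuous on the closed strip, holomorphic in the open strip, and with boundary values
`F₀ t = F (i t)` and `F₁ t = F (1 + i t)` that are continuous functions into `A₀` and `A₁`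
vanishing at infinity. -/
structure IsAdmissible (A₀ A₁ : FunctionSpace X) (F : ℂ → (A₀.sum A₁).Elem)
    (F₀ : ℝ → A₀.Elem) (F₁ : ℝ → A₁.Elem) : Prop where
  differentiableOn : DifferentiableOn ℂ F (verticalStrip 0 1)
  continuousOn : ContinuousOn F (verticalClosedStrip 0 1)
  bounded : ∃ C : ℝ, ∀ z ∈ verticalClosedStrip 0 1, ‖F z‖ ≤ C
  left_eq : ∀ t : ℝ, toFun (F (t * Complex.I)) = toFun (F₀ t)
  right_eq : ∀ t : ℝ, toFun (F (1 + t * Complex.I)) = toFun (F₁ t)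
  left_continuous : Continuous F₀
  right_continuous : Continuous F₁
  left_tendsto : Filter.Tendsto (fun t => ‖F₀ t‖) (Filter.cocompact ℝ) (𝓝 0)
  right_tendsto : Filter.Tendsto (fun t => ‖F₁ t‖) (Filter.cocompact ℝ) (𝓝 0)

theorem IsAdmissible.zero (A₀ A₁ : FunctionSpace X) : IsAdmissible A₀ A₁ 0 0 0 where
  differentiableOn := differentiableOn_const _
  continuousOn := continuousOn_const
  bounded := ⟨0, fun _ _ => norm_zero.le⟩
  left_eq := fun _ => (toFun_zero _).trans (toFun_zero _).symm
  right_eq := fun _ => (toFun_zero _).trans (toFun_zero _).symm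
  left_continuous := continuous_const
  right_continuous := continuous_const
  left_tendsto := by simp
  right_tendsto := by simp

theorem IsAdmissible.add {A₀ A₁ : FunctionSpace X} {F G : ℂ → (A₀.sum A₁).Elem}
    {F₀ G₀ : ℝ → A₀.Elem} {F₁ G₁ : ℝ → A₁.Elem} (hF : IsAdmissible A₀ A₁ F F₀ F₁)
    (hG : IsAdmissible A₀ A₁ G G₀ G₁) : IsAdmissible A₀ A₁ (F + G) (F₀ + G₀) (F₁ + G₁) where
  differentiableOn := hF.differentiableOn.add hG.differentiableOn
  continuousOn := hF.continuousOn.add hG.continuousOn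
  bounded := by
    obtain ⟨C, hC⟩ := hF.bounded
    obtain ⟨D, hD⟩ := hG.bounded
    exact ⟨C + D, fun z hz => (norm_add_le _ _).trans (add_le_add (hC z hz) (hD z hz))⟩
  left_eq := fun t => by
    simp only [Pi.add_apply, toFun_add, hF.left_eq, hG.left_eq]
  right_eq := fun t => by
    simp only [Pi.add_apply, toFun_add, hF.right_eq, hG.right_eq]
  left_continuous := hF.left_continuous.add hG.left_continuous
  right_continuous := hF.right_continuous.add hG.right_continuous
  left_tendsto := squeeze_zero (fun _ => norm_nonneg _) (fun _ => norm_add_le _ _)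
    (by simpa using hF.left_tendsto.add hG.left_tendsto)
  right_tendsto := squeeze_zero (fun _ => norm_nonneg _) (fun _ => norm_add_le _ _)
    (by simpa using hF.right_tendsto.add hG.right_tendsto)

theorem IsAdmissible.smul {A₀ A₁ : FunctionSpace X} {F : ℂ → (A₀.sum A₁).Elem}
    {F₀ : ℝ → A₀.Elem} {F₁ : ℝ → A₁.Elem} (c : ℂ) (hF : IsAdmissible A₀ A₁ F F₀ F₁) :
    IsAdmissible A₀ A₁ (c • F) (c • F₀) (c • F₁) where
  differentiableOn := hF.differentiableOn.const_smul c
  continuousOn := hF.continuousOn.const_smul c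
  bounded := by
    obtain ⟨C, hC⟩ := hF.bounded
    refine ⟨‖c‖ * C, fun z hz => ?_⟩
    rw [Pi.smul_apply, norm_smul]
    exact mul_le_mul_of_nonneg_left (hC z hz) (norm_nonneg c)
  left_eq := fun t => by
    simp only [Pi.smul_apply, toFun_smul, hF.left_eq]
  right_eq := fun t => by
    simp only [Pi.smul_apply, toFun_smul, hF.right_eq]
  left_continuous := hF.left_continuous.const_smul c
  right_continuous := hF.right_continuous.const_smul c
  left_tendsto := by
    simpa [norm_smul] using hF.left_tendsto.const_mul ‖c‖
  right_tendsto := by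
    simpa [norm_smul] using hF.right_tendsto.const_mul ‖c‖

/-- `f = F θ` for some `F` in Calderón's class whose norm
`max (sup_t ‖F (i t)‖_{A₀}) (sup_t ‖F (1 + i t)‖_{A₁})` is at most `r`. -/
def InterpCost (A₀ A₁ : FunctionSpace X) (θ : ℝ) (f : X → ℂ) (r : ℝ) : Prop :=
  ∃ F F₀ F₁, IsAdmissible A₀ A₁ F F₀ F₁ ∧ toFun (F (θ : ℂ)) = f ∧
    ∀ t : ℝ, ‖F₀ t‖ ≤ r ∧ ‖F₁ t‖ ≤ r

theorem IsAdmissible.norm_eval_le {A₀ A₁ : FunctionSpace X} {F : ℂ → (A₀.sum A₁).Elem}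
    {F₀ : ℝ → A₀.Elem} {F₁ : ℝ → A₁.Elem} (hF : IsAdmissible A₀ A₁ F F₀ F₁) {x : X} {B : ℝ}
    (hB : 0 ≤ B) (h₀ : ∀ t, ‖toFun (F₀ t) x‖ ≤ B) (h₁ : ∀ t, ‖toFun (F₁ t) x‖ ≤ B) {z : ℂ}
    (hz : z ∈ verticalClosedStrip 0 1) : ‖toFun (F z) x‖ ≤ B := by
  let G : ℂ → ℂ := fun z => (A₀.sum A₁).evalCLM x (F z)
  have hcl : closure (verticalStrip 0 1) = verticalClosedStrip 0 1 := by
    rw [verticalStrip, Complex.closure_preimage_re, closure_Ioo zero_ne_one, verticalClosedStrip]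
  have hd : DiffContOnCl ℂ G (verticalStrip 0 1) :=
    ⟨((A₀.sum A₁).evalCLM x).differentiable.comp_differentiableOn hF.differentiableOn, by
      rw [hcl]
      exact ((A₀.sum A₁).evalCLM x).continuous.comp_continuousOn hF.continuousOn⟩
  have hbd : BddAbove ((norm ∘ G) '' verticalClosedStrip 0 1) := by
    obtain ⟨C, hC⟩ := hF.bounded
    refine ⟨‖(A₀.sum A₁).evalCLM x‖ * C, ?_⟩
    rintro _ ⟨w, hw, rfl⟩
    exact (ContinuousLinearMap.le_opNorm _ _).trans
      (mul_le_mul_of_nonneg_left (hC w hw) (norm_nonneg _))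
  have key := Complex.HadamardThreeLines.norm_le_interp_of_mem_verticalClosedStrip₀₁' G hz hd hbd
    (a := B) (b := B) (fun w hw => ?_) (fun w hw => ?_)
  · rw [← Real.rpow_add_of_nonneg hB (sub_nonneg.2 hz.2) hz.1, sub_add_cancel,
      Real.rpow_one] at key
    exact key
  · have hw' : w = w.im * Complex.I := by
      apply Complex.ext <;> simp [show w.re = 0 from hw]
    change ‖toFun (F w) x‖ ≤ B
    rw [hw', hF.left_eq]
    exact h₀ _
  · have hw' : w = 1 + w.im * Complex.I := by
      apply Complex.ext <;> simp [show w.re = 1 from hw]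
    change ‖toFun (F w) x‖ ≤ B
    rw [hw', hF.right_eq]
    exact h₁ _

theorem isCost_interpCost (A₀ A₁ : FunctionSpace X) {θ : ℝ} (hθ : θ ∈ Set.Icc (0 : ℝ) 1) :
    IsCost (InterpCost A₀ A₁ θ) where
  zero := ⟨0, 0, 0, .zero A₀ A₁, toFun_zero _, fun _ => ⟨norm_zero.le, norm_zero.le⟩⟩
  nonneg := fun ⟨_, F₀, _, _, _, h⟩ => (norm_nonneg (F₀ 0)).trans (h 0).1
  add := by
    rintro _ _ r s ⟨F, F₀, F₁, hF, rfl, h⟩ ⟨G, G₀, G₁, hG, rfl, h'⟩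
    exact ⟨F + G, F₀ + G₀, F₁ + G₁, hF.add hG, toFun_add _ _, fun t =>
      ⟨(norm_add_le _ _).trans (add_le_add (h t).1 (h' t).1),
        (norm_add_le _ _).trans (add_le_add (h t).2 (h' t).2)⟩⟩
  smul := by
    rintro c _ r ⟨F, F₀, F₁, hF, rfl, h⟩
    refine ⟨c • F, c • F₀, c • F₁, hF.smul c, toFun_smul _ _, fun t => ?_⟩
    simp only [Pi.smul_apply, norm_smul]
    exact ⟨mul_le_mul_of_nonneg_left (h t).1 (norm_nonneg c),
      mul_le_mul_of_nonneg_left (h t).2 (norm_nonneg c)⟩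
  eval := fun x => by
    obtain ⟨C, hC0, hC⟩ := norm_toFun_le A₀ x
    obtain ⟨D, hD0, hD⟩ := norm_toFun_le A₁ x
    refine ⟨max C D, le_max_of_le_left hC0, ?_⟩
    rintro _ r ⟨F, F₀, F₁, hF, rfl, h⟩
    have hr : 0 ≤ r := (norm_nonneg (F₀ 0)).trans (h 0).1
    refine hF.norm_eval_le (mul_nonneg (le_max_of_le_left hC0) hr)
      (fun t => (hC _).trans ?_) (fun t => (hD _).trans ?_) ?_
    · exact mul_le_mul (le_max_left C D) (h t).1 (norm_nonneg _) (le_max_of_le_left hC0)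
    · exact mul_le_mul (le_max_right C D) (h t).2 (norm_nonneg _) (le_max_of_le_left hC0)
    · simpa [verticalClosedStrip] using hθ

/-- The complex interpolation space `[A₀, A₁]_[θ]`, for `0 ≤ θ ≤ 1`. -/
def interp (A₀ A₁ : FunctionSpace X) {θ : ℝ} (hθ : θ ∈ Set.Icc (0 : ℝ) 1) : FunctionSpace X :=
  ofCost (InterpCost A₀ A₁ θ) (isCost_interpCost A₀ A₁ hθ)

end FunctionSpace

open FunctionSpace

section Hilbert

variable {X : Type*} (M : Type*) [NormedAddCommGroup M] [InnerProductSpace ℂ M] [RKHS ℂ M X ℂ]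

variable {M} in
theorem norm_rkhs_eval_le (x : X) : ∃ C : ℝ, 0 ≤ C ∧ ∀ f : M, ‖f x‖ ≤ C * ‖f‖ := by
  let L : M →L[ℂ] ℂ := (ContinuousLinearMap.proj x).comp (RKHS.coeCLM ℂ)
  exact ⟨‖L‖, norm_nonneg L, fun f => L.le_opNorm f⟩

/-- The multipliers of `M`. -/
def multipliers : Set (X → ℂ) := {φ | ∀ f : M, ∃ g : M, (g : X → ℂ) = φ * (f : X → ℂ)}

/-- The multiplier algebra of `M` is a dense subset of `M`. -/
def MultipliersDense : Prop :=
  (∀ φ ∈ multipliers M, ∃ g : M, (g : X → ℂ) = φ) ∧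
    Dense {g : M | (g : X → ℂ) ∈ multipliers M}

variable {M} in
theorem MultipliersDense.exists_one (hA : MultipliersDense M) : ∃ e : M, (e : X → ℂ) = 1 :=
  hA.1 1 fun f => ⟨f, (one_mul _).symm⟩

variable {M} in
/-- The constant function `1`, as an element of `M`. -/
def MultipliersDense.one (hA : MultipliersDense M) : M := hA.exists_one.choose

variable {M} in
theorem MultipliersDense.coe_one (hA : MultipliersDense M) : (hA.one : X → ℂ) = 1 :=
  hA.exists_one.choose_spec

/-- `h = ∑ fₙ gₙ` with `∑ ‖fₙ‖ ‖gₙ‖ = r`. -/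
def WeakProductCost (h : X → ℂ) (r : ℝ) : Prop :=
  ∃ f g : ℕ → M, HasSum (fun n => ‖f n‖ * ‖g n‖) r ∧ ∀ x, HasSum (fun n => f n x * g n x) (h x)

theorem isCost_weakProductCost : IsCost (WeakProductCost (X := X) M) where
  zero := ⟨0, 0, by simp, fun x => by simp⟩
  nonneg := fun ⟨f, g, h, _⟩ => h.nonneg fun n => by positivity
  add := by
    rintro h h' r s ⟨f, g, hr, hh⟩ ⟨f', g', hs, hh'⟩
    let e := Equiv.natSumNatEquivNat
    refine ⟨Sum.elim f f' ∘ e.symm, Sum.elim g g' ∘ e.symm, ?_, fun x => ?_⟩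
    · refine (Equiv.hasSum_iff e).1 ?_
      refine HasSum.sum (f := (fun n => ‖(Sum.elim f f' ∘ e.symm) n‖ *
        ‖(Sum.elim g g' ∘ e.symm) n‖) ∘ e) ?_ ?_
      · simpa [Function.comp_def] using hr
      · simpa [Function.comp_def] using hs
    · refine (Equiv.hasSum_iff e).1 ?_
      refine HasSum.sum (f := (fun n => (Sum.elim f f' ∘ e.symm) n x *
        (Sum.elim g g' ∘ e.symm) n x) ∘ e) ?_ ?_
      · simpa [Function.comp_def] using hh x
      · simpa [Function.comp_def] using hh' x
  smul := by
    rintro c h r ⟨f, g, hr, hh⟩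
    refine ⟨fun n => c • f n, g, ?_, fun x => ?_⟩
    · simpa [norm_smul, mul_assoc] using hr.mul_left ‖c‖
    · simpa [mul_assoc] using (hh x).mul_left c
  eval := fun x => by
    obtain ⟨C, hC0, hC⟩ := norm_rkhs_eval_le (M := M) x
    refine ⟨C * C, by positivity, ?_⟩
    rintro h r ⟨f, g, hr, hh⟩
    refine (hh x).norm_le_of_bounded (hr.mul_left (C * C)) fun n => ?_
    calc ‖f n x * g n x‖ = ‖f n x‖ * ‖g n x‖ := norm_mul _ _
      _ ≤ (C * ‖f n‖) * (C * ‖g n‖) :=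
          mul_le_mul (hC _) (hC _) (norm_nonneg _) (mul_nonneg hC0 (norm_nonneg _))
      _ = C * C * (‖f n‖ * ‖g n‖) := by ring

/-- The weak product `M ⊙ M`. -/
def weakProduct : FunctionSpace X := ofCost (WeakProductCost M) (isCost_weakProductCost M)

variable {M}

/-- Bounded operators from `M` to the complex conjugate of `M` are the same as bounded
conjugate-linear maps `S : M → M`; as functionals on the projective tensor product of `M` with
itself they act by `f ⊗ g ↦ ⟨g, S f⟩` (linear in `g`), which is `inner ℂ (S f) g` in Mathlib's
convention. This says that `S` annihilates the kernel of the map `∑ fₙ ⊗ gₙ ↦ ∑ fₙ gₙ` from the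
projective tensor product to the weak product. -/
def AnnihilatesKernel (S : M →L⋆[ℂ] M) : Prop :=
  ∀ f g : ℕ → M, Summable (fun n => ‖f n‖ * ‖g n‖) → (∀ x : X, HasSum (fun n => f n x * g n x) 0) →
    HasSum (fun n => inner ℂ (S (f n)) (g n)) 0

/-- `b = S 1` for an operator `S` that annihilates the kernel and has norm at most `r`. (If the
multipliers are dense then `S` is determined by `b`: it is the Hankel operator with symbol `b`.) -/
def HanCost (hA : MultipliersDense M) (b : X → ℂ) (r : ℝ) : Prop :=
  ∃ S : M →L⋆[ℂ] M, AnnihilatesKernel S ∧ (S hA.one : X → ℂ) = b ∧ ‖S‖ ≤ r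

theorem isCost_hanCost (hA : MultipliersDense M) : IsCost (HanCost hA) where
  zero := ⟨0, fun _ _ _ _ => by simp, by simp, by simp⟩
  nonneg := fun ⟨S, _, _, h⟩ => (norm_nonneg S).trans h
  add := by
    rintro _ _ r s ⟨S, hS, rfl, hr⟩ ⟨T, hT, rfl, hs⟩
    refine ⟨S + T, fun f g h h0 => ?_, by simp, (norm_add_le _ _).trans (add_le_add hr hs)⟩
    simpa [inner_add_left] using (hS f g h h0).add (hT f g h h0)
  smul := by
    rintro c _ r ⟨S, hS, rfl, hr⟩
    refine ⟨c • S, fun f g h h0 => ?_, by simp, ?_⟩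
    · simpa [inner_smul_left, mul_comm] using (hS f g h h0).mul_left (starRingEnd ℂ c)
    · rw [norm_smul]
      gcongr
  eval := fun x => by
    obtain ⟨C, hC0, hC⟩ := norm_rkhs_eval_le (M := M) x
    refine ⟨C * ‖hA.one‖, by positivity, ?_⟩
    rintro _ r ⟨S, -, rfl, hr⟩
    calc ‖S hA.one x‖ ≤ C * ‖S hA.one‖ := hC _
      _ ≤ C * (r * ‖hA.one‖) := by
          gcongr
          exact (S.le_opNorm _).trans (mul_le_mul_of_nonneg_right hr (norm_nonneg _))
      _ = C * ‖hA.one‖ * r := by ring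

/-- The space `Han` of Hankel symbols; the norm of `b` is the norm of its Hankel operator. -/
def han (hA : MultipliersDense M) : FunctionSpace X := ofCost (HanCost hA) (isCost_hanCost hA)

theorem exponent_mem_Icc {p : ℝ} (hp : 1 ≤ p) : (p - 1) / p ∈ Set.Icc (0 : ℝ) 1 :=
  ⟨div_nonneg (by linarith) (by linarith), div_le_one_of_le₀ (by linarith) (by linarith)⟩

/-- The space `H^p = [M ⊙ M, Han]_[θ]` with `θ = (p - 1) / p`, for `1 ≤ p < ∞`. -/
def hSpace (hA : MultipliersDense M) (p : ℝ) (hp : 1 ≤ p) : FunctionSpace X :=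
  interp (weakProduct M) (han hA) (exponent_mem_Icc hp)

end Hilbert

end

noncomputable section

open scoped Topology
open Complex.HadamardThreeLines (verticalStrip verticalClosedStrip)

namespace FunctionSpace

variable {X : Type*}

/-! Everything reduces to a couple `A₁ ⊆ A₀` of function spaces whose inclusion has norm at most
`K`. Here `K = ‖1‖²`: a Hankel symbol `b = S 1` is the one-term product `b · 1`, so its weak product
norm is at most `‖S 1‖ ‖1‖ ≤ ‖S‖ ‖1‖²` (`han_includedWithBound_weakProduct`).

For such a couple `A₀ + A₁` embeds in `A₀`, and a function `F` in Calderón's class of norm at most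
`r` is an `A₀`-valued function bounded by `r` on the left line and by `K r` on the right line. The
three lines theorem gives `‖F z‖ ≤ K ^ Re z * r` in `A₀` (`IsAdmissible.norm_sum_left_le`). At `z =
θ` this bounds `[A₀, A₁]_θ ⊆ A₀` by `K ^ θ`. Constant functions bound `A₁ ⊆ [A₀, A₁]_θ` by `K ^ (1 -
θ)`. For `θ ≤ η < 1`, restricting `F` to a narrower strip ending at the right line and rescaling
bounds `[A₀, A₁]_η ⊆ [A₀, A₁]_θ` by `K ^ (η - θ)`. The last two rest on `exists_interp_norm_le`,
which supplies decay at infinity and balances unequal boundary bounds. With `θ = 1 - 1/p` these are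
the stated exponents.

All the spaces carry an infimum of costs, so completeness follows once costs are countably
subadditive (`completeSpace_ofCost`). This is checked by summing absolutely convergent series of
representations. -/

theorem toFun_injective {A : FunctionSpace X} : Function.Injective (toFun : A.Elem → X → ℂ) :=
  Subtype.val_injective

theorem evalCLM_apply (A : FunctionSpace X) (x : X) (f : A.Elem) : A.evalCLM x f = toFun f x := rfl

theorem continuous_toFun_apply (A : FunctionSpace X) (x : X) :
    Continuous fun f : A.Elem => toFun f x :=
  (A.evalCLM x).continuous

theorem hasSum_toFun {A : FunctionSpace X} {ι : Type*} {u : ι → A.Elem} {a : A.Elem}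
    (h : HasSum u a) (x : X) : HasSum (fun i => toFun (u i) x) (toFun a x) :=
  (A.evalCLM x).hasSum h

/-! ### Spaces defined by a cost -/

section ofCost

variable {R : (X → ℂ) → ℝ → Prop} (hR : IsCost R)
include hR

theorem exists_norm_le_of_cost {f : X → ℂ} {r : ℝ} (h : R f r) :
    ∃ g : (ofCost R hR).Elem, toFun g = f ∧ ‖g‖ ≤ r :=
  ⟨⟨f, r, h⟩, rfl, csInf_le ⟨0, fun _ h => hR.nonneg h⟩ h⟩

theorem norm_le_of_cost (f : (ofCost R hR).Elem) {r : ℝ} (h : R (toFun f) r) : ‖f‖ ≤ r :=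
  csInf_le ⟨0, fun _ h => hR.nonneg h⟩ h

theorem exists_cost_lt (f : (ofCost R hR).Elem) {r : ℝ} (h : ‖f‖ < r) :
    ∃ s, s < r ∧ R (toFun f) s := by
  obtain ⟨s, hs, hlt⟩ := exists_lt_of_csInf_lt (s := {r | R (toFun f) r}) f.2 h
  exact ⟨s, hlt, hs⟩

/-- To bound `ofCost R` into `A`, it is enough to bound every representation. -/
theorem includedWithBound_of_cost {A : FunctionSpace X} {C : ℝ} (hC : 0 ≤ C)
    (h : ∀ f r, R f r → ∃ g : A.Elem, toFun g = f ∧ ‖g‖ ≤ C * r) :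
    (ofCost R hR).IncludedWithBound A C := by
  intro f
  obtain ⟨s, hs⟩ : ∃ s, R (toFun f) s := f.2
  obtain ⟨g, hg, -⟩ := h _ _ hs
  refine ⟨g, hg, ?_⟩
  refine le_of_forall_pos_le_add fun ε hε => ?_
  obtain ⟨t, ht, hR'⟩ := exists_cost_lt hR f
    (lt_add_of_pos_right ‖f‖ (show 0 < ε / (C + 1) by positivity))
  obtain ⟨g', hg', hle⟩ := h _ _ hR'
  -- Nearly optimal representations vary with `ε`, but all give the same element of `A`, since it is
  -- determined by its function.
  rw [toFun_injective (hg.trans hg'.symm)]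
  have h1 : C * (ε / (C + 1)) ≤ ε := by
    rw [mul_div_assoc', div_le_iff₀ (by positivity)]
    nlinarith
  nlinarith [mul_le_mul_of_nonneg_left ht.le hC]

/-- A space of functions that is defined by a countably subadditive cost is complete. -/
theorem completeSpace_ofCost
    (h : ∀ (f : ℕ → X → ℂ) (r : ℕ → ℝ), (∀ n, R (f n) (r n)) → Summable r →
      ∃ g, R g (∑' n, r n) ∧ ∀ x, HasSum (fun n => f n x) (g x)) :
    CompleteSpace (ofCost R hR).Elem := by
  refine NormedAddCommGroup.completeSpace_of_summable_imp_tendsto fun u hu => ?_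
  -- The geometric slack keeps nearly optimal costs summable.
  have hex : ∀ n, ∃ s, s < ‖u n‖ + (1 / 2 : ℝ) ^ n ∧ R (toFun (u n)) s := fun n =>
    exists_cost_lt hR (u n) (lt_add_of_pos_right _ (by positivity))
  choose r hlt hr using hex
  have hsum : Summable r := Summable.of_nonneg_of_le (fun n => hR.nonneg (hr n))
    (fun n => (hlt n).le) (hu.add summable_geometric_two)
  obtain ⟨g, hg, hgx⟩ := h _ _ hr hsum
  obtain ⟨a, rfl, -⟩ := exists_norm_le_of_cost hR hg
  refine ⟨a, ?_⟩
  rw [tendsto_iff_norm_sub_tendsto_zero]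
  refine squeeze_zero (fun _ => norm_nonneg _) (fun N => ?_) (tendsto_sum_nat_add r)
  rw [norm_sub_rev]
  refine norm_le_of_cost hR _ ?_
  -- Subadditivity is applied again, to the tail: the remainder after `N` terms then costs at most
  -- the tail of `∑ r n`, which gives convergence in norm and not just pointwise.
  obtain ⟨g', hg', hgx'⟩ := h (fun n => toFun (u (n + N))) (fun n => r (n + N))
    (fun n => hr _) ((summable_nat_add_iff N).2 hsum)
  convert hg' using 1
  funext x
  have h1 := (hasSum_nat_add_iff' N).2 (hgx x)
  rw [(hgx' x).unique h1]
  simp only [← evalCLM_apply, map_sub, map_sum]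

end ofCost

/-! ### Sums and interpolation -/

theorem norm_sum_le_left {A₀ A₁ : FunctionSpace X} (f : (A₀.sum A₁).Elem) (a : A₀.Elem)
    (h : toFun f = toFun a) : ‖f‖ ≤ ‖a‖ :=
  norm_le_of_cost _ f ⟨a, 0, by rw [toFun_zero, add_zero]; exact h.symm, by simp⟩

theorem norm_sum_le_right {A₀ A₁ : FunctionSpace X} (f : (A₀.sum A₁).Elem) (a : A₁.Elem)
    (h : toFun f = toFun a) : ‖f‖ ≤ ‖a‖ :=
  norm_le_of_cost _ f ⟨0, a, by rw [toFun_zero, zero_add]; exact h.symm, by simp⟩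

theorem completeSpace_sum (A₀ A₁ : FunctionSpace X) [CompleteSpace A₀.Elem]
    [CompleteSpace A₁.Elem] : CompleteSpace (A₀.sum A₁).Elem := by
  refine completeSpace_ofCost _ fun f r hf hr => ?_
  choose a b hab hle using hf
  have ha : Summable fun n => ‖a n‖ := Summable.of_nonneg_of_le (fun _ => norm_nonneg _)
    (fun n => (le_add_of_nonneg_right (norm_nonneg _)).trans (hle n)) hr
  have hb : Summable fun n => ‖b n‖ := Summable.of_nonneg_of_le (fun _ => norm_nonneg _)
    (fun n => (le_add_of_nonneg_left (norm_nonneg _)).trans (hle n)) hr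
  refine ⟨_, ⟨∑' n, a n, ∑' n, b n, rfl, ?_⟩, fun x => ?_⟩
  · calc ‖∑' n, a n‖ + ‖∑' n, b n‖ ≤ ∑' n, ‖a n‖ + ∑' n, ‖b n‖ :=
          add_le_add (norm_tsum_le_tsum_norm ha) (norm_tsum_le_tsum_norm hb)
      _ = ∑' n, (‖a n‖ + ‖b n‖) := (ha.tsum_add hb).symm
      _ ≤ ∑' n, r n := (ha.add hb).tsum_le_tsum hle hr
  · have := (hasSum_toFun ha.of_norm.hasSum x).add (hasSum_toFun hb.of_norm.hasSum x)
    simpa [← hab] using this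

theorem isOpen_verticalStrip (a b : ℝ) : IsOpen (verticalStrip a b) :=
  isOpen_Ioo.preimage Complex.continuous_re

theorem closure_verticalStrip : closure (verticalStrip 0 1) = verticalClosedStrip 0 1 := by
  rw [verticalStrip, Complex.closure_preimage_re, closure_Ioo zero_ne_one, verticalClosedStrip]

theorem mem_left (t : ℝ) : (t * Complex.I : ℂ) ∈ verticalClosedStrip 0 1 := by
  simp [verticalClosedStrip]

theorem mem_right (t : ℝ) : (1 + t * Complex.I : ℂ) ∈ verticalClosedStrip 0 1 := by
  simp [verticalClosedStrip]

section

variable {A₀ A₁ : FunctionSpace X} {F : ℂ → (A₀.sum A₁).Elem} {F₀ : ℝ → A₀.Elem} {F₁ : ℝ → A₁.Elem}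

/-- The three lines theorem for the image of a function in Calderón's class under a bounded
operator. -/
theorem IsAdmissible.norm_map_le {E : Type*} [NormedAddCommGroup E] [NormedSpace ℂ E]
    (hF : IsAdmissible A₀ A₁ F F₀ F₁) (L : (A₀.sum A₁).Elem →L[ℂ] E) {a b : ℝ}
    (ha : ∀ t : ℝ, ‖L (F (t * Complex.I))‖ ≤ a) (hb : ∀ t : ℝ, ‖L (F (1 + t * Complex.I))‖ ≤ b)
    {z : ℂ} (hz : z ∈ verticalClosedStrip 0 1) : ‖L (F z)‖ ≤ a ^ (1 - z.re) * b ^ z.re := by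
  refine Complex.HadamardThreeLines.norm_le_interp_of_mem_verticalClosedStrip₀₁'
    (fun z => L (F z)) hz ⟨L.differentiable.comp_differentiableOn hF.differentiableOn, ?_⟩ ?_
    (fun w hw => ?_) (fun w hw => ?_)
  · rw [closure_verticalStrip]
    exact L.continuous.comp_continuousOn hF.continuousOn
  · obtain ⟨C, hC⟩ := hF.bounded
    refine ⟨‖L‖ * C, ?_⟩
    rintro _ ⟨w, hw, rfl⟩
    exact (L.le_opNorm _).trans (mul_le_mul_of_nonneg_left (hC w hw) (norm_nonneg _))
  · have hw' : w = w.im * Complex.I := by apply Complex.ext <;> simp [show w.re = 0 from hw]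
    rw [hw']
    exact ha _
  · have hw' : w = 1 + w.im * Complex.I := by apply Complex.ext <;> simp [show w.re = 1 from hw]
    rw [hw']
    exact hb _

/-- The norm of `A₀ + A₁` is dominated by that of each summand, so the boundary bounds pass to it
and the three lines theorem carries them inside. This makes convergence in Calderón's norm uniform
on the closed strip. -/
theorem IsAdmissible.norm_le {r : ℝ} (hF : IsAdmissible A₀ A₁ F F₀ F₁)
    (h : ∀ t, ‖F₀ t‖ ≤ r ∧ ‖F₁ t‖ ≤ r) {z : ℂ} (hz : z ∈ verticalClosedStrip 0 1) :
    ‖F z‖ ≤ r := by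
  have hr : 0 ≤ r := (norm_nonneg _).trans (h 0).1
  have := hF.norm_map_le (ContinuousLinearMap.id ℂ _) (a := r) (b := r)
    (fun t => (norm_sum_le_left _ _ (hF.left_eq t)).trans (h t).1)
    (fun t => (norm_sum_le_right _ _ (hF.right_eq t)).trans (h t).2) hz
  rwa [← Real.rpow_add_of_nonneg hr (sub_nonneg.2 hz.2) hz.1, sub_add_cancel,
    Real.rpow_one] at this

end

/-- A series of functions in Calderón's class with summable bounds converges uniformly on the closed
strip and on both boundary lines, so holomorphy and continuity survive; decay at infinity survives
by dominated convergence. -/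
theorem completeSpace_interp (A₀ A₁ : FunctionSpace X) [CompleteSpace A₀.Elem]
    [CompleteSpace A₁.Elem] {θ : ℝ} (hθ : θ ∈ Set.Icc (0 : ℝ) 1) :
    CompleteSpace (interp A₀ A₁ hθ).Elem := by
  have := completeSpace_sum A₀ A₁
  refine completeSpace_ofCost _ fun f r hf hr => ?_
  choose F F₀ F₁ hF hf hle using hf
  have hFz : ∀ n, ∀ z ∈ verticalClosedStrip 0 1, ‖F n z‖ ≤ r n := fun n z hz =>
    (hF n).norm_le (hle n) hz
  have hs : ∀ z ∈ verticalClosedStrip 0 1, HasSum (fun n => F n z) (∑' n, F n z) := fun z hz =>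
    (Summable.of_norm_bounded hr fun n => hFz n z hz).hasSum
  have hs₀ : ∀ t, HasSum (fun n => F₀ n t) (∑' n, F₀ n t) := fun t =>
    (Summable.of_norm_bounded hr fun n => (hle n t).1).hasSum
  have hs₁ : ∀ t, HasSum (fun n => F₁ n t) (∑' n, F₁ n t) := fun t =>
    (Summable.of_norm_bounded hr fun n => (hle n t).2).hasSum
  have hsub : verticalStrip 0 1 ⊆ verticalClosedStrip 0 1 := fun z hz => ⟨hz.1.le, hz.2.le⟩
  refine ⟨_, ⟨fun z => ∑' n, F n z, fun t => ∑' n, F₀ n t, fun t => ∑' n, F₁ n t, ?_, rfl,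
    fun t => ⟨tsum_of_norm_bounded hr.hasSum fun n => (hle n t).1,
      tsum_of_norm_bounded hr.hasSum fun n => (hle n t).2⟩⟩, fun x => ?_⟩
  · constructor
    · exact Complex.differentiableOn_tsum_of_summable_norm hr (fun n => (hF n).differentiableOn)
        (isOpen_verticalStrip 0 1) fun n z hz => hFz n z (hsub hz)
    · exact continuousOn_tsum (fun n => (hF n).continuousOn) hr hFz
    · exact ⟨_, fun z hz => tsum_of_norm_bounded hr.hasSum fun n => hFz n z hz⟩
    -- The two series converge in different norms; they are compared through point evaluations,
    -- which are continuous for both.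
    · intro t
      funext x
      refine (hasSum_toFun (hs _ (mem_left t)) x).unique ?_
      simpa only [(hF _).left_eq] using hasSum_toFun (hs₀ t) x
    · intro t
      funext x
      refine (hasSum_toFun (hs _ (mem_right t)) x).unique ?_
      simpa only [(hF _).right_eq] using hasSum_toFun (hs₁ t) x
    · exact continuous_tsum (fun n => (hF n).left_continuous) hr fun n t => (hle n t).1
    · exact continuous_tsum (fun n => (hF n).right_continuous) hr fun n t => (hle n t).2
    · rw [← tendsto_zero_iff_norm_tendsto_zero]
      simpa using tendsto_tsum_of_dominated_convergence (g := fun _ => (0 : A₀.Elem)) hr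
        (fun n => tendsto_zero_iff_norm_tendsto_zero.2 (hF n).left_tendsto)
        (Filter.Eventually.of_forall fun t n => (hle n t).1)
    · rw [← tendsto_zero_iff_norm_tendsto_zero]
      simpa using tendsto_tsum_of_dominated_convergence (g := fun _ => (0 : A₁.Elem)) hr
        (fun n => tendsto_zero_iff_norm_tendsto_zero.2 (hF n).right_tendsto)
        (Filter.Eventually.of_forall fun t n => (hle n t).2)
  · simpa only [hf] using
      hasSum_toFun (hs (θ : ℂ) (by simpa [verticalClosedStrip] using hθ)) x

/-! ### Interpolation of a couple with `A₁ ⊆ A₀` -/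

section

variable {A B : FunctionSpace X} {C : ℝ}

/-- A bounded inclusion, as a bounded linear map. -/
def IncludedWithBound.toCLM (h : B.IncludedWithBound A C) : B.Elem →L[ℂ] A.Elem :=
  LinearMap.mkContinuous
    { toFun := fun f => (h f).choose
      map_add' := fun f g => toFun_injective <| by
        rw [(h _).choose_spec.1, toFun_add, toFun_add, (h _).choose_spec.1, (h _).choose_spec.1]
      map_smul' := fun c f => toFun_injective <| by
        rw [(h _).choose_spec.1, RingHom.id_apply, toFun_smul, toFun_smul, (h _).choose_spec.1] }
    C fun f => (h f).choose_spec.2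

theorem IncludedWithBound.toFun_toCLM (h : B.IncludedWithBound A C) (f : B.Elem) :
    toFun (h.toCLM f) = toFun f :=
  (h f).choose_spec.1

theorem IncludedWithBound.norm_toCLM_le (h : B.IncludedWithBound A C) (f : B.Elem) :
    ‖h.toCLM f‖ ≤ C * ‖f‖ :=
  (h f).choose_spec.2

theorem IncludedWithBound.contractively (h : B.IncludedWithBound A C) (hC : C ≤ 1) :
    B.ContractivelyIncluded A := fun f => by
  obtain ⟨g, hg, hle⟩ := h f
  exact ⟨g, hg, hle.trans (mul_le_of_le_one_left (norm_nonneg _) hC)⟩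

theorem includedWithBound_of_isEmpty [IsEmpty X] (A B : FunctionSpace X) (C : ℝ) :
    B.IncludedWithBound A C := fun f => by
  have hf : f = 0 := toFun_injective (Subsingleton.elim _ _)
  exact ⟨0, Subsingleton.elim _ _, by simp [hf]⟩

end

section

variable {A₀ A₁ : FunctionSpace X} {K : ℝ}

/-- This turns functions in Calderón's class into `A₀`-valued functions that are still holomorphic
inside the strip and continuous on it. -/
theorem IncludedWithBound.sum_left (h : A₁.IncludedWithBound A₀ K) :
    (A₀.sum A₁).IncludedWithBound A₀ (max 1 K) := by
  refine includedWithBound_of_cost _ (zero_le_one.trans (le_max_left _ _)) ?_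
  rintro _ r ⟨a, b, rfl, hr⟩
  refine ⟨a + h.toCLM b, by rw [toFun_add, h.toFun_toCLM], ?_⟩
  calc ‖a + h.toCLM b‖ ≤ 1 * ‖a‖ + K * ‖b‖ := by
        rw [one_mul]
        exact (norm_add_le _ _).trans (add_le_add_right (h.norm_toCLM_le b) _)
    _ ≤ max 1 K * ‖a‖ + max 1 K * ‖b‖ := by
        gcongr
        · exact le_max_left _ _
        · exact le_max_right _ _
    _ ≤ max 1 K * r := by
        rw [← mul_add]
        exact mul_le_mul_of_nonneg_left hr (zero_le_one.trans (le_max_left _ _))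

/-- On the line `Re z = α`, a function in Calderón's class takes values in `A₀` of norm at most
`K ^ α` times its norm. -/
theorem IsAdmissible.norm_sum_left_le {F : ℂ → (A₀.sum A₁).Elem} {F₀ : ℝ → A₀.Elem}
    {F₁ : ℝ → A₁.Elem} {r : ℝ} (hF : IsAdmissible A₀ A₁ F F₀ F₁) (hK : 0 ≤ K)
    (hA : A₁.IncludedWithBound A₀ K)
    (h : ∀ t, ‖F₀ t‖ ≤ r ∧ ‖F₁ t‖ ≤ r) {z : ℂ} (hz : z ∈ verticalClosedStrip 0 1) :
    ‖hA.sum_left.toCLM (F z)‖ ≤ K ^ z.re * r := by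
  have hr : 0 ≤ r := (norm_nonneg _).trans (h 0).1
  have key := hF.norm_map_le hA.sum_left.toCLM (a := r) (b := K * r) (fun t => ?_) (fun t => ?_) hz
  · rwa [Real.mul_rpow hK hr, mul_left_comm, ← Real.rpow_add_of_nonneg hr (sub_nonneg.2 hz.2) hz.1,
      sub_add_cancel, Real.rpow_one] at key
  · have : hA.sum_left.toCLM (F (t * Complex.I)) = F₀ t :=
      toFun_injective (by rw [IncludedWithBound.toFun_toCLM, hF.left_eq])
    rw [this]
    exact (h t).1
  · have : hA.sum_left.toCLM (F (1 + t * Complex.I)) = hA.toCLM (F₁ t) :=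
      toFun_injective (by
        rw [IncludedWithBound.toFun_toCLM, IncludedWithBound.toFun_toCLM, hF.right_eq])
    rw [this]
    exact (hA.norm_toCLM_le _).trans (mul_le_mul_of_nonneg_left (h t).2 hK)

theorem interp_includedWithBound_left (hK : 0 ≤ K) (hA : A₁.IncludedWithBound A₀ K) {θ : ℝ}
    (hθ : θ ∈ Set.Icc (0 : ℝ) 1) : (interp A₀ A₁ hθ).IncludedWithBound A₀ (K ^ θ) := by
  refine includedWithBound_of_cost _ (Real.rpow_nonneg hK _) ?_
  rintro _ r ⟨F, F₀, F₁, hF, rfl, h⟩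
  exact ⟨hA.sum_left.toCLM (F θ), IncludedWithBound.toFun_toCLM _ _,
    hF.norm_sum_left_le hK hA h (by simpa [verticalClosedStrip] using hθ)⟩

end

/-! ### Decay at infinity and monotonicity in the parameter -/

/-- The Gaussian factor, normalized at `θ`, that makes a function decay at infinity and that
equalizes the bounds `exp a` and `exp b` on the two boundary lines. -/
def gaussianFactor (θ δ a b : ℝ) (z : ℂ) : ℂ :=
  Complex.exp (δ * (z ^ 2 - θ ^ 2) + (z - θ) * (a - b))

section gaussianFactor

variable {θ δ a b : ℝ}

theorem gaussianFactor_self : gaussianFactor θ δ a b θ = 1 := by simp [gaussianFactor]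

theorem differentiable_gaussianFactor : Differentiable ℂ (gaussianFactor θ δ a b) := by
  unfold gaussianFactor
  fun_prop

theorem norm_gaussianFactor (z : ℂ) : ‖gaussianFactor θ δ a b z‖ =
    Real.exp (δ * (z.re ^ 2 - z.im ^ 2 - θ ^ 2) + (z.re - θ) * (a - b)) := by
  rw [gaussianFactor, Complex.norm_exp]
  congr 1
  simp [pow_two]

/-- The linear term of the exponent balances the two lines: `a - θ (a - b)` on the left and `b + (1
- θ) (a - b)` on the right both equal `(1 - θ) a + θ b`. -/
theorem norm_gaussianFactor_left (t : ℝ) : ‖gaussianFactor θ δ a b (t * Complex.I)‖ * Real.exp a =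
    Real.exp ((1 - θ) * a + θ * b + δ * (0 - θ ^ 2 - t ^ 2)) := by
  rw [norm_gaussianFactor, ← Real.exp_add]
  congr 1
  simp
  ring

theorem norm_gaussianFactor_right (t : ℝ) :
    ‖gaussianFactor θ δ a b (1 + t * Complex.I)‖ * Real.exp b =
      Real.exp ((1 - θ) * a + θ * b + δ * (1 - θ ^ 2 - t ^ 2)) := by
  rw [norm_gaussianFactor, ← Real.exp_add]
  congr 1
  simp
  ring

theorem norm_gaussianFactor_le (hδ : 0 ≤ δ) (hθ : θ ∈ Set.Icc (0 : ℝ) 1) {z : ℂ}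
    (hz : z ∈ verticalClosedStrip 0 1) :
    ‖gaussianFactor θ δ a b z‖ ≤ Real.exp (δ + |a - b|) := by
  rw [norm_gaussianFactor]
  have hz0 : 0 ≤ z.re := hz.1
  have hz1 : z.re ≤ 1 := hz.2
  have h1 : (z.re - θ) * (a - b) ≤ |a - b| := by
    refine (le_abs_self _).trans ?_
    rw [abs_mul]
    exact mul_le_of_le_one_left (abs_nonneg _)
      (abs_le.2 ⟨by linarith [hθ.2], by linarith [hθ.1]⟩)
  have h2 : δ * (z.re ^ 2 - z.im ^ 2 - θ ^ 2) ≤ δ * 1 :=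
    mul_le_mul_of_nonneg_left (by nlinarith [sq_nonneg z.im, sq_nonneg θ]) hδ
  gcongr
  linarith

theorem tendsto_exp_gaussian (hδ : 0 < δ) (c d : ℝ) :
    Filter.Tendsto (fun t : ℝ => Real.exp (c + δ * (d - t ^ 2))) (Filter.cocompact ℝ) (𝓝 0) := by
  have h1 : Filter.Tendsto (fun t : ℝ => t ^ 2) (Filter.cocompact ℝ) Filter.atTop := by
    have := (Filter.tendsto_pow_atTop (α := ℝ) two_ne_zero).comp
      (tendsto_norm_cocompact_atTop (E := ℝ))
    refine this.congr fun t => ?_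
    simp
  refine Real.tendsto_exp_atBot.comp ?_
  refine Filter.tendsto_atBot_add_const_left _ _ (Filter.Tendsto.const_mul_atBot hδ ?_)
  simpa only [sub_eq_add_neg, Function.comp_apply] using Filter.tendsto_atBot_add_const_left _ d
    (Filter.tendsto_neg_atTop_atBot.comp h1)

end gaussianFactor

/-- In the definition of the interpolation space, one may drop the condition that the boundary
values vanish at infinity, and one may bound the boundary values by different constants. -/
theorem exists_interp_norm_le {A₀ A₁ : FunctionSpace X} {θ : ℝ} (hθ : θ ∈ Set.Icc (0 : ℝ) 1)
    {G : ℂ → (A₀.sum A₁).Elem} {G₀ : ℝ → A₀.Elem} {G₁ : ℝ → A₁.Elem}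
    (hd : DifferentiableOn ℂ G (verticalStrip 0 1))
    (hc : ContinuousOn G (verticalClosedStrip 0 1))
    (hbd : ∃ C : ℝ, ∀ z ∈ verticalClosedStrip 0 1, ‖G z‖ ≤ C)
    (hl : ∀ t : ℝ, toFun (G (t * Complex.I)) = toFun (G₀ t))
    (hr : ∀ t : ℝ, toFun (G (1 + t * Complex.I)) = toFun (G₁ t))
    (hc₀ : Continuous G₀) (hc₁ : Continuous G₁) {a b : ℝ} (ha : 0 < a) (hb : 0 < b)
    (h₀ : ∀ t, ‖G₀ t‖ ≤ a) (h₁ : ∀ t, ‖G₁ t‖ ≤ b) :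
    ∃ g : (interp A₀ A₁ hθ).Elem, toFun g = toFun (G θ) ∧ ‖g‖ ≤ a ^ (1 - θ) * b ^ θ := by
  set P := (1 - θ) * Real.log a + θ * Real.log b with hP
  have hP' : a ^ (1 - θ) * b ^ θ = Real.exp P := by
    rw [Real.rpow_def_of_pos ha, Real.rpow_def_of_pos hb, ← Real.exp_add, hP]
    ring_nf
  -- The error `δ` comes from the right line, where the Gaussian part is at most `exp (δ (1 - θ²))`.
  have main : ∀ δ > 0, InterpCost A₀ A₁ θ (toFun (G θ)) (Real.exp (P + δ)) := fun δ hδ => by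
    set m := gaussianFactor θ δ (Real.log a) (Real.log b) with hm
    have hmc : Continuous m := differentiable_gaussianFactor.continuous
    have hml : ∀ t : ℝ, ‖m (t * Complex.I) • G₀ t‖ ≤ Real.exp (P + δ * (0 - θ ^ 2 - t ^ 2)) :=
      fun t => by
        rw [norm_smul, hP, ← norm_gaussianFactor_left, Real.exp_log ha]
        exact mul_le_mul_of_nonneg_left (h₀ t) (norm_nonneg _)
    have hmr : ∀ t : ℝ, ‖m (1 + t * Complex.I) • G₁ t‖ ≤ Real.exp (P + δ * (1 - θ ^ 2 - t ^ 2)) :=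
      fun t => by
        rw [norm_smul, hP, ← norm_gaussianFactor_right, Real.exp_log hb]
        exact mul_le_mul_of_nonneg_left (h₁ t) (norm_nonneg _)
    refine ⟨fun z => m z • G z, fun t => m (t * Complex.I) • G₀ t,
      fun t => m (1 + t * Complex.I) • G₁ t, ⟨?_, ?_, ?_, ?_, ?_, ?_, ?_, ?_, ?_⟩, ?_, ?_⟩
    · exact differentiable_gaussianFactor.differentiableOn.smul hd
    · exact hmc.continuousOn.smul hc
    · obtain ⟨C, hC⟩ := hbd
      refine ⟨Real.exp (δ + |Real.log a - Real.log b|) * C, fun z hz => ?_⟩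
      rw [norm_smul]
      exact mul_le_mul (norm_gaussianFactor_le hδ.le hθ hz) (hC z hz) (norm_nonneg _)
        (Real.exp_nonneg _)
    · exact fun t => by rw [toFun_smul, toFun_smul, hl]
    · exact fun t => by rw [toFun_smul, toFun_smul, hr]
    · exact (hmc.comp (by fun_prop)).smul hc₀
    · exact (hmc.comp (by fun_prop)).smul hc₁
    · exact squeeze_zero (fun _ => norm_nonneg _) hml (tendsto_exp_gaussian hδ _ _)
    · exact squeeze_zero (fun _ => norm_nonneg _) hmr (tendsto_exp_gaussian hδ _ _)
    · change toFun (m θ • G θ) = _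
      rw [hm, gaussianFactor_self, one_smul]
    · intro t
      constructor
      · refine (hml t).trans (Real.exp_le_exp.2 ?_)
        nlinarith [mul_nonneg hδ.le (sq_nonneg θ), mul_nonneg hδ.le (sq_nonneg t)]
      · refine (hmr t).trans (Real.exp_le_exp.2 ?_)
        nlinarith [mul_nonneg hδ.le (sq_nonneg θ), mul_nonneg hδ.le (sq_nonneg t)]
  -- The choice `δ = 1` only shows membership; the resulting `g` does not depend on `δ`, so its norm
  -- can be bounded by letting `δ` tend to `0`.
  obtain ⟨g, hg, -⟩ := exists_norm_le_of_cost (isCost_interpCost A₀ A₁ hθ) (main 1 one_pos)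
  refine ⟨g, hg, ?_⟩
  rw [hP']
  have hlim : Filter.Tendsto (fun δ : ℝ => Real.exp (P + δ)) (𝓝[>] 0) (𝓝 (Real.exp P)) := by
    have : Continuous fun δ : ℝ => Real.exp (P + δ) := by fun_prop
    simpa using (this.tendsto 0).mono_left nhdsWithin_le_nhds
  refine ge_of_tendsto hlim ?_
  filter_upwards [self_mem_nhdsWithin] with δ hδ
  exact norm_le_of_cost _ g (by rw [hg]; exact main δ hδ)

/-! ### Inclusions between the spaces of the interpolation scale -/

section

variable {A₀ A₁ : FunctionSpace X} {K : ℝ}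

/-- The constant function `f` has boundary bounds `K ‖f‖` in `A₀` and `‖f‖` in `A₁`, whose weighted
geometric mean is `K ^ (1 - θ) ‖f‖`. -/
theorem includedWithBound_interp (hK : 0 < K) (hA : A₁.IncludedWithBound A₀ K) {θ : ℝ}
    (hθ : θ ∈ Set.Icc (0 : ℝ) 1) : A₁.IncludedWithBound (interp A₀ A₁ hθ) (K ^ (1 - θ)) := by
  intro f
  rcases eq_or_ne f 0 with rfl | hf
  · exact ⟨0, rfl, by simp⟩
  have hf' : 0 < ‖f‖ := norm_pos_iff.2 hf
  obtain ⟨F, hF, -⟩ := exists_norm_le_of_cost (isCost_sumCost A₀ A₁) (f := toFun f)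
    ⟨0, f, by rw [toFun_zero, zero_add], le_rfl⟩
  obtain ⟨g, hg, hle⟩ := exists_interp_norm_le (A₀ := A₀) (A₁ := A₁) hθ (G := fun _ => F)
    (G₀ := fun _ => hA.toCLM f) (G₁ := fun _ => f) (differentiableOn_const _) continuousOn_const
    ⟨‖F‖, fun _ _ => le_rfl⟩ (fun _ => hF.trans (hA.toFun_toCLM f).symm) (fun _ => hF)
    continuous_const continuous_const (mul_pos hK hf') hf' (fun _ => hA.norm_toCLM_le f)
    fun _ => le_rfl
  refine ⟨g, hg.trans hF, hle.trans_eq ?_⟩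
  rw [Real.mul_rpow hK.le hf'.le, mul_assoc, ← Real.rpow_add hf', sub_add_cancel, Real.rpow_one]

/-- An affine map `φ` fixes the right line pointwise up to a rescaling of height, sends the left
line to an intermediate line, and takes `θ` to `η`. The bound for `F` on the intermediate line is
already improved to `K ^ (1 - s) * r`. -/
theorem interp_includedWithBound_interp (hK : 0 < K) (hA : A₁.IncludedWithBound A₀ K) {θ η : ℝ}
    (hθ : θ ∈ Set.Icc (0 : ℝ) 1) (hη : η ∈ Set.Icc (0 : ℝ) 1) (hle : θ ≤ η) (hη1 : η < 1) :
    (interp A₀ A₁ hη).IncludedWithBound (interp A₀ A₁ hθ) (K ^ (η - θ)) := by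
  refine includedWithBound_of_cost _ (Real.rpow_nonneg hK.le _) ?_
  rintro _ r ⟨F, F₀, F₁, hF, rfl, h⟩
  have hηs : (η : ℂ) ∈ verticalClosedStrip 0 1 := by simpa [verticalClosedStrip] using hη
  have hr : 0 ≤ r := (norm_nonneg _).trans (h 0).1
  -- Balancing the boundary bounds takes their logarithms, so `r = 0` is treated apart; then `F`
  -- vanishes on the strip.
  rcases hr.eq_or_lt with rfl | hr
  · refine ⟨0, ?_, by simp⟩
    rw [norm_le_zero_iff.1 (hF.norm_le h hηs)]
    rfl
  have hθ1 : 0 < 1 - θ := by linarith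
  -- The ratio of the distances of `η` and `θ` to the right line; the left line goes to `Re z = 1 -
  -- s`.
  set s : ℝ := (1 - η) / (1 - θ) with hs
  have hs0 : 0 < s := div_pos (by linarith) hθ1
  have hs1 : s ≤ 1 := (div_le_one hθ1).2 (by linarith)
  have hsθ : s * (1 - θ) = 1 - η := div_mul_cancel₀ _ hθ1.ne'
  set φ : ℂ → ℂ := fun z => 1 - s * (1 - z) with hφ
  have hφre : ∀ z, (φ z).re = 1 - s * (1 - z.re) := fun z => by simp [hφ]
  have hφd : Differentiable ℂ φ := by fun_prop
  have hφθ : φ θ = η := by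
    change (1 - s * (1 - θ) : ℂ) = η
    norm_cast
    rw [hsθ, sub_sub_cancel]
  have hφopen : Set.MapsTo φ (verticalStrip 0 1) (verticalStrip 0 1) := fun z hz => by
    have h0 : 0 < z.re := hz.1
    have h1 : z.re < 1 := hz.2
    change (φ z).re ∈ Set.Ioo 0 1
    rw [hφre]
    constructor <;> nlinarith
  have hφcl : Set.MapsTo φ (verticalClosedStrip 0 1) (verticalClosedStrip 0 1) := fun z hz => by
    have h0 : 0 ≤ z.re := hz.1
    have h1 : z.re ≤ 1 := hz.2
    change (φ z).re ∈ Set.Icc 0 1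
    rw [hφre]
    constructor <;> nlinarith
  have hφr : ∀ t : ℝ, φ (1 + t * Complex.I) = 1 + (s * t : ℝ) * Complex.I := fun t => by
    simp only [hφ]
    push_cast
    ring
  have hleft : Continuous fun t : ℝ => φ (t * Complex.I) := hφd.continuous.comp (by fun_prop)
  obtain ⟨g, hg, hgle⟩ := exists_interp_norm_le hθ (G := fun z => F (φ z))
    (G₀ := fun t => hA.sum_left.toCLM (F (φ (t * Complex.I)))) (G₁ := fun t => F₁ (s * t))
    (a := K ^ (1 - s) * r) (b := r)
    (hF.differentiableOn.comp hφd.differentiableOn hφopen)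
    (hF.continuousOn.comp hφd.continuous.continuousOn hφcl)
    ⟨r, fun z hz => hF.norm_le h (hφcl hz)⟩
    (fun t => (hA.sum_left.toFun_toCLM _).symm)
    (fun t => by rw [hφr, hF.right_eq])
    (hA.sum_left.toCLM.continuous.comp
      (hF.continuousOn.comp_continuous hleft fun t => hφcl (mem_left t)))
    (hF.right_continuous.comp (by fun_prop)) (mul_pos (Real.rpow_pos_of_pos hK _) hr) hr
    (fun t => by
      refine (hF.norm_sum_left_le hK.le hA h (hφcl (mem_left t))).trans_eq ?_
      rw [hφre]
      simp)
    (fun t => (h _).2)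
  refine ⟨g, by rw [hg, hφθ], hgle.trans_eq ?_⟩
  rw [Real.mul_rpow (Real.rpow_nonneg hK.le _) hr.le, mul_assoc, ← Real.rpow_add hr,
    sub_add_cancel, Real.rpow_one, ← Real.rpow_mul hK.le]
  -- The exponents agree because `(1 - s) (1 - θ) = (1 - θ) - (1 - η)`.
  congr 2
  linear_combination -hsθ

end

end FunctionSpace

open FunctionSpace

/-! ### The weak product and the Hankel symbols -/

section

variable {X : Type*} {M : Type*} [NormedAddCommGroup M] [InnerProductSpace ℂ M] [RKHS ℂ M X ℂ]

theorem summable_apply_mul_apply {ι : Type*} {f g : ι → M}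
    (h : Summable fun i => ‖f i‖ * ‖g i‖) (x : X) : Summable fun i => f i x * g i x := by
  obtain ⟨C, hC0, hC⟩ := norm_rkhs_eval_le (M := M) x
  refine Summable.of_norm_bounded (h.mul_left (C * C)) fun i => ?_
  calc ‖f i x * g i x‖ = ‖f i x‖ * ‖g i x‖ := norm_mul _ _
    _ ≤ (C * ‖f i‖) * (C * ‖g i‖) :=
        mul_le_mul (hC _) (hC _) (norm_nonneg _) (mul_nonneg hC0 (norm_nonneg _))
    _ = C * C * (‖f i‖ * ‖g i‖) := by ring

theorem weakProductCost_of_equiv {ι : Type*} (e : ℕ ≃ ι) {f g : ι → M} {h : X → ℂ} {r : ℝ}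
    (hr : HasSum (fun i => ‖f i‖ * ‖g i‖) r) (hh : ∀ x, HasSum (fun i => f i x * g i x) (h x)) :
    WeakProductCost M h r :=
  ⟨fun n => f (e n), fun n => g (e n), (e.hasSum_iff (f := fun i => ‖f i‖ * ‖g i‖)).2 hr,
    fun x => (e.hasSum_iff (f := fun i => f i x * g i x)).2 (hh x)⟩

/-- A series of representations is a double series, absolutely summable over `ℕ × ℕ`; enumerating
the pairs makes it a single representation whose cost is the sum of the costs. -/
theorem completeSpace_weakProduct : CompleteSpace (weakProduct (X := X) M).Elem := by
  refine completeSpace_ofCost _ fun h r hr hsum => ?_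
  choose f g hfg hx using hr
  have hnn : 0 ≤ fun p : ℕ × ℕ => ‖f p.1 p.2‖ * ‖g p.1 p.2‖ := fun p => by positivity
  have hs : Summable fun p : ℕ × ℕ => ‖f p.1 p.2‖ * ‖g p.1 p.2‖ :=
    (summable_prod_of_nonneg hnn).2
      ⟨fun n => (hfg n).summable, by simpa only [(hfg _).tsum_eq] using hsum⟩
  have hr' : HasSum (fun p : ℕ × ℕ => ‖f p.1 p.2‖ * ‖g p.1 p.2‖) (∑' n, r n) := by
    rw [hs.hasSum_iff, hs.tsum_prod' fun n => (hfg n).summable]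
    simp only [(hfg _).tsum_eq]
  have hxs : ∀ x : X, HasSum (fun p : ℕ × ℕ => f p.1 p.2 x * g p.1 p.2 x)
      (∑' p : ℕ × ℕ, f p.1 p.2 x * g p.1 p.2 x) := fun x =>
    (summable_apply_mul_apply (f := fun p : ℕ × ℕ => f p.1 p.2) (g := fun p => g p.1 p.2)
      hs x).hasSum
  exact ⟨_, weakProductCost_of_equiv Nat.pairEquiv.symm hr' hxs, fun x =>
    (hxs x).prod_fiberwise fun n => hx n x⟩

/-- The double series of `⟨S i (f n), g n⟩` is dominated by `r i * (‖f n‖ * ‖g n‖)`, so Fubini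
applies: summing over `n` first gives `0`, and summing over `i` first gives the series for `T`. -/
theorem AnnihilatesKernel.of_hasSum {ι : Type*} {S : ι → M →L⋆[ℂ] M} {T : M →L⋆[ℂ] M} {r : ι → ℝ}
    (hS : ∀ i, AnnihilatesKernel (S i)) (hle : ∀ i, ‖S i‖ ≤ r i) (hr : Summable r)
    (hT : HasSum S T) : AnnihilatesKernel T := by
  intro f g hfg h0
  have hr0 : ∀ i, 0 ≤ r i := fun i => (norm_nonneg _).trans (hle i)
  have hs : Summable fun p : ι × ℕ => inner ℂ (S p.1 (f p.2)) (g p.2) := by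
    refine Summable.of_norm_bounded (hr.mul_of_nonneg hfg hr0 fun n => by positivity)
      fun p => ?_
    calc ‖inner ℂ (S p.1 (f p.2)) (g p.2)‖ ≤ ‖S p.1 (f p.2)‖ * ‖g p.2‖ := norm_inner_le_norm _ _
      _ ≤ (r p.1 * ‖f p.2‖) * ‖g p.2‖ := by
          gcongr
          exact (S p.1).le_of_opNorm_le (hle _) _
      _ = r p.1 * (‖f p.2‖ * ‖g p.2‖) := mul_assoc _ _ _
  have h1 := hs.hasSum.prod_fiberwise fun i => hS i f g hfg h0
  have h2 : ∀ n, HasSum (fun i => inner ℂ (S i (f n)) (g n)) (inner ℂ (T (f n)) (g n)) := fun n =>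
    hT.map
      ({ toFun := fun S => inner ℂ (S (f n)) (g n)
         map_zero' := by simp
         map_add' := fun S T => by simp } : (M →L⋆[ℂ] M) →+ ℂ)
      (show Continuous fun S : M →L⋆[ℂ] M => inner ℂ (S (f n)) (g n) by fun_prop)
  have h3 := ((Equiv.prodComm ℕ ι).hasSum_iff.2 hs.hasSum).prod_fiberwise h2
  rwa [h1.unique hasSum_zero] at h3

theorem completeSpace_han [CompleteSpace M] (hA : MultipliersDense M) :
    CompleteSpace (han hA).Elem := by
  refine completeSpace_ofCost _ fun b r hb hr => ?_
  choose S hS hSb hle using hb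
  have hT : HasSum S (∑' n, S n) := (Summable.of_norm_bounded hr hle).hasSum
  refine ⟨_, ⟨∑' n, S n, .of_hasSum hS hle hr hT, rfl, tsum_of_norm_bounded hr.hasSum hle⟩,
    fun x => ?_⟩
  simp only [← hSb]
  exact hT.map
    ({ toFun := fun S => S hA.one x
       map_zero' := by simp
       map_add' := fun S T => by simp } : (M →L⋆[ℂ] M) →+ ℂ)
    (((ContinuousLinearMap.proj x).comp (RKHS.coeCLM ℂ) : M →L[ℂ] ℂ).continuous.comp
      (show Continuous fun S : M →L⋆[ℂ] M => S hA.one by fun_prop))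

theorem han_includedWithBound_weakProduct (hA : MultipliersDense M) :
    (han hA).IncludedWithBound (weakProduct M) (‖hA.one‖ ^ 2) := by
  refine includedWithBound_of_cost _ (by positivity) ?_
  rintro _ r ⟨S, -, rfl, hr⟩
  obtain ⟨g, hg, hle⟩ := exists_norm_le_of_cost (isCost_weakProductCost M)
    (f := (S hA.one : X → ℂ)) (r := ‖S hA.one‖ * ‖hA.one‖)
    ⟨Pi.single 0 (S hA.one), Pi.single 0 hA.one, by
      convert hasSum_single (f := fun n => ‖(Pi.single 0 (S hA.one) : ℕ → M) n‖ *
        ‖(Pi.single 0 hA.one : ℕ → M) n‖) 0 fun n hn => by simp [hn]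
      · simp
      · simp, fun x => by
      convert hasSum_single (f := fun n => (Pi.single 0 (S hA.one) : ℕ → M) n x *
        (Pi.single 0 hA.one : ℕ → M) n x) 0 fun n hn => by simp [hn]
      simp [hA.coe_one]⟩
  refine ⟨g, hg, hle.trans ?_⟩
  calc ‖S hA.one‖ * ‖hA.one‖ ≤ (r * ‖hA.one‖) * ‖hA.one‖ := by
        gcongr
        exact S.le_of_opNorm_le hr _
    _ = ‖hA.one‖ ^ 2 * r := by ring

/-! ### The spaces `H^p` -/

theorem isEmpty_of_one_eq_zero (hA : MultipliersDense M) (h : hA.one = 0) : IsEmpty X :=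
  ⟨fun x => by simpa [h] using congrFun hA.coe_one x⟩

theorem hSpace_isBanachFunctionSpace [CompleteSpace M] (hA : MultipliersDense M) (p : ℝ)
    (hp : 1 ≤ p) : (hSpace hA p hp).IsBanachFunctionSpace := by
  have := completeSpace_weakProduct (X := X) (M := M)
  have := completeSpace_han hA
  exact ⟨completeSpace_interp _ _ _, continuous_toFun_apply _⟩

theorem hSpace_includedWithBound (hA : MultipliersDense M) (p q : ℝ) (hp : 1 ≤ p) (hpq : p ≤ q) :
    (hSpace hA p hp).IncludedWithBound (weakProduct M) (‖hA.one‖ ^ (2 * (1 - 1 / p))) ∧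
    (hSpace hA q (hp.trans hpq)).IncludedWithBound (hSpace hA p hp)
      (‖hA.one‖ ^ (2 * (1 / p - 1 / q))) ∧
    (han hA).IncludedWithBound (hSpace hA q (hp.trans hpq)) (‖hA.one‖ ^ (2 / q)) := by
  -- The interpolation bounds need `K > 0`. If `1 = 0` in `M`, then `X` is empty and all the spaces
  -- are trivial.
  by_cases h : hA.one = 0
  · have := isEmpty_of_one_eq_zero hA h
    exact ⟨includedWithBound_of_isEmpty _ _ _, includedWithBound_of_isEmpty _ _ _,
      includedWithBound_of_isEmpty _ _ _⟩
  have hK : 0 < ‖hA.one‖ ^ 2 := by positivity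
  have hp0 : 0 < p := by linarith
  have hq0 : 0 < q := by linarith
  have hpow : ∀ s : ℝ, ‖hA.one‖ ^ (2 * s) = (‖hA.one‖ ^ 2) ^ s := fun s => by
    rw [Real.rpow_mul (norm_nonneg _), Real.rpow_two]
  have hinc := han_includedWithBound_weakProduct hA
  refine ⟨?_, ?_, ?_⟩
  · rw [hpow, show 1 - 1 / p = (p - 1) / p by field_simp]
    exact interp_includedWithBound_left hK.le hinc _
  · rw [hpow, show 1 / p - 1 / q = (q - 1) / q - (p - 1) / p by field_simp; ring]
    refine interp_includedWithBound_interp hK hinc _ _ ?_ ?_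
    · rw [div_le_div_iff₀ hp0 hq0]
      nlinarith
    -- Finiteness of `q` is what keeps the parameter strictly below `1`.
    · rw [div_lt_one hq0]
      linarith
  · rw [show 2 / q = 2 * (1 - (q - 1) / q) by field_simp; ring, hpow]
    exact includedWithBound_interp hK hinc _

end

end

theorem mainTheorem9 {X M : Type*} [NormedAddCommGroup M] [InnerProductSpace ℂ M] [CompleteSpace M]
    [RKHS ℂ M X ℂ] (hA : MultipliersDense M) :
    (∀ (p : ℝ) (hp : 1 ≤ p), (hSpace hA p hp).IsBanachFunctionSpace) ∧
    (∀ (p q : ℝ) (hp : 1 ≤ p) (hpq : p ≤ q),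
      (hSpace hA p hp).IncludedWithBound (weakProduct M) (‖hA.one‖ ^ (2 * (1 - 1 / p))) ∧
      (hSpace hA q (hp.trans hpq)).IncludedWithBound (hSpace hA p hp)
        (‖hA.one‖ ^ (2 * (1 / p - 1 / q))) ∧
      (han hA).IncludedWithBound (hSpace hA q (hp.trans hpq)) (‖hA.one‖ ^ (2 / q))) ∧
    (‖hA.one‖ ≤ 1 → ∀ (p q : ℝ) (hp : 1 ≤ p) (hpq : p ≤ q),
      (hSpace hA p hp).ContractivelyIncluded (weakProduct M) ∧
      (hSpace hA q (hp.trans hpq)).ContractivelyIncluded (hSpace hA p hp) ∧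
      (han hA).ContractivelyIncluded (hSpace hA q (hp.trans hpq))) := by
  refine ⟨hSpace_isBanachFunctionSpace hA, hSpace_includedWithBound hA,
    fun h1 p q hp hpq => ?_⟩
  obtain ⟨h₁, h₂, h₃⟩ := hSpace_includedWithBound hA p q hp hpq
  have hp0 : 0 < p := by linarith
  have hq0 : 0 < q := by linarith
  refine ⟨h₁.contractively (Real.rpow_le_one (norm_nonneg _) h1 ?_),
    h₂.contractively (Real.rpow_le_one (norm_nonneg _) h1 ?_),
    h₃.contractively (Real.rpow_le_one (norm_nonneg _) h1 (by positivity))⟩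
  · have : 1 / p ≤ 1 := (div_le_one hp0).2 hp
    linarith
  · have : 1 / q ≤ 1 / p := one_div_le_one_div_of_le hp0 hpq
    linarith
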